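/- Let $\mathrm{ML}$ be the basic modal language: $\varphi ::= \bot \mid \top \mid p \mid \neg\varphi \mid \varphi\lor\psi \mid \varphi\land\psi \mid \Diamond\varphi \mid \Box\varphi$, with $p$ ranging over a countably infinite set of propositional variables, and $\varphi\to\psi := \neg\varphi\lor\psi$. A formula is *positive* if every occurrence of every variable in it is in the scope of an even number of negations. *Box-forms* of a placeholder $\sharp$ are generated as follows: $\sharp$ is a box-form; if $\mathbf B$ is a box-form, then so are $\Box\mathbf B$ and $A\to\mathbf B$ for every positive formula $A$. Substituting a variable $p$ for $\sharp$ gives a *box-formula* $\mathbf B(p)$ with *head* $p$; all occurrences of variables in it other than this last occurrence of $p$ are *inessential*. The *dependency digraph* of a set $\mathcal B$ of box-formulae has the heads of its members as vertices, and an edge from $p$ to $q$ whenever $p$ is a head and occurs inessentially in a box-formula of $\mathcal B$ with head $q$. A *monadic inductive formula* is a formula $\varphi$ that is built up from $\top$, $\bot$, positive formulae and negations of box-formulae from a set $\mathcal B$ of box-formulae occurring as subformulae of $\varphi$, by applying conjunctions, disjunctions and boxes, where the dependency digraph of $\mathcal B$ is acyclic (has no oriented cycles, including loops). In particular this holds if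 $\varphi$ is built in this way from any box-formulae and the dependency digraph of the set of all box-formulae that occur as subformulae of $\varphi$ is acyclic. **Theorem.** Every monadic inductive formula $\varphi$ is 1. *elementary (locally first-order definable)*: there is a first-order formula $\alpha(x)$ in the language with equality and one binary predicate $R$ such that for every Kripke frame $\mathfrak F=(W,R)$ with $W \neq\emptyset$ and every $w\in W$, $\varphi$ is valid at $w$ in $\mathfrak F$ (true at $w$ under every valuation) if and only if $\mathfrak F\models\alpha(x:=w)$; and 2. *canonical*: for every normal modal logic $\Lambda$ with $\varphi\in\Lambda$, $\varphi$ is valid on the canonical frame of $\Lambda$. Here a normal modal logic is a set of formulae that contains all propositional tautologies, all formulae $\Box(\varphi\to\psi)\to(\Box\varphi\to\Box\psi)$ and all formulae $\Diamond\varphi\leftrightarrow\neg\Box\neg\varphi$, and is closed under modus ponens, necessitation and uniform substitution; the worlds of its canonical frame are the maximal $\Lambda$-consistent sets of formulae, and $\Gamma R\Delta$ holds iff $\psi\in\Delta$ whenever $\Box\psi\in\Gamma$. -/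

import Mathlib

universe u

/-! ### The basic modal language, Kripke semantics, first-order frame language -/

/-- Formulae of the basic modal language; the propositional variables are indexed by `ℕ`. -/
inductive MLFormula : Type
  | var (p : ℕ)
  | bot
  | top
  | neg (φ : MLFormula)
  | or (φ ψ : MLFormula)
  | and (φ ψ : MLFormula)
  | dia (φ : MLFormula)
  | box (φ : MLFormula)

namespace MLFormula

/-- The defined connective `φ → ψ`, that is `¬φ ∨ ψ`. -/
def imp (φ ψ : MLFormula) : MLFormula := (φ.neg).or ψ

/-- The defined connective `φ ↔ ψ`. -/
def iff (φ ψ : MLFormula) : MLFormula := (φ.imp ψ).and (ψ.imp φ)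

/-- `φ.occ true` is the set of variables with an occurrence in `φ` in the scope of an even number
of negations, `φ.occ false` the set of those with an occurrence in the scope of an odd number. -/
def occ : MLFormula → Bool → Set ℕ
  | var p, b => {q | q = p ∧ b = true}
  | bot, _ => ∅
  | top, _ => ∅
  | neg φ, b => φ.occ (!b)
  | or φ ψ, b => φ.occ b ∪ ψ.occ b
  | and φ ψ, b => φ.occ b ∪ ψ.occ b
  | dia φ, b => φ.occ b
  | box φ, b => φ.occ b

/-- The propositional variables that occur in a formula. -/
def vars (φ : MLFormula) : Set ℕ := φ.occ true ∪ φ.occ false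

/-- A formula is positive if every occurrence of every variable is in the scope of an even number
of negations. -/
def IsPositive (φ : MLFormula) : Prop := φ.occ false = ∅

/-- The subformulae of a formula, including itself. -/
def subformulae : MLFormula → Set MLFormula
  | var p => {var p}
  | bot => {bot}
  | top => {top}
  | neg φ => insert (neg φ) φ.subformulae
  | or φ ψ => insert (or φ ψ) (φ.subformulae ∪ ψ.subformulae)
  | and φ ψ => insert (and φ ψ) (φ.subformulae ∪ ψ.subformulae)
  | dia φ => insert (dia φ) φ.subformulae
  | box φ => insert (box φ) φ.subformulae

/-- Uniform substitution of formulae for the propositional variables. -/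
def subst (σ : ℕ → MLFormula) : MLFormula → MLFormula
  | var p => σ p
  | bot => bot
  | top => top
  | neg φ => neg (φ.subst σ)
  | or φ ψ => or (φ.subst σ) (ψ.subst σ)
  | and φ ψ => and (φ.subst σ) (ψ.subst σ)
  | dia φ => dia (φ.subst σ)
  | box φ => box (φ.subst σ)

/-- Truth at a world of the Kripke model `(W, R, V)`. -/
def Holds {W : Type*} (R : W → W → Prop) (V : ℕ → Set W) : MLFormula → W → Prop
  | var p, u => u ∈ V p
  | bot, _ => False
  | top, _ => True
  | neg φ, u => ¬ φ.Holds R V u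
  | or φ ψ, u => φ.Holds R V u ∨ ψ.Holds R V u
  | and φ ψ, u => φ.Holds R V u ∧ ψ.Holds R V u
  | dia φ, u => ∃ w, R u w ∧ φ.Holds R V w
  | box φ, u => ∀ w, R u w → φ.Holds R V w

/-- Validity at a world of the frame `(W, R)`: truth there under every valuation. -/
def ValidAt {W : Type*} (R : W → W → Prop) (w : W) (φ : MLFormula) : Prop :=
  ∀ V : ℕ → Set W, φ.Holds R V w

/-- Validity on the frame `(W, R)`. -/
def ValidOn {W : Type*} (R : W → W → Prop) (φ : MLFormula) : Prop :=
  ∀ w : W, φ.ValidAt R w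

end MLFormula

/-- The only nonlogical symbol of the first-order frame language: a binary predicate. -/
inductive FrameRel : ℕ → Type
  | R : FrameRel 2

/-- The first-order language (with equality) of one binary predicate. -/
def frameLanguage : FirstOrder.Language := ⟨fun _ => Empty, FrameRel⟩

/-- The frame `(W, R)` as a first-order structure. -/
@[reducible]
def frameStructure {W : Type*} (R : W → W → Prop) : frameLanguage.Structure W where
  funMap := fun f => f.elim
  RelMap := fun r => match r with
    | FrameRel.R => fun x => R (x 0) (x 1)

/-- `α` is true in the frame `(W, R)` when its only free variable denotes `w`. -/
def FrameSatisfies {W : Type*} (R : W → W → Prop) (α : frameLanguage.Formula (Fin 1)) (w : W) :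
    Prop :=
  letI := frameStructure R
  α.Realize (fun _ => w)

namespace MLFormula

/-- Local first-order definability: there is a first-order formula `α(x)` such that, for every
frame (nonempty set with a binary relation) and every world `w` of it, `φ` is valid at `w` iff
`α` is true of `w`. -/
def LocallyFirstOrderDefinable.{v} (φ : MLFormula) : Prop :=
  ∃ α : frameLanguage.Formula (Fin 1),
    ∀ (W : Type v) [Nonempty W] (R : W → W → Prop) (w : W),
      φ.ValidAt R w ↔ FrameSatisfies R α w

/-! ### Normal modal logics, canonical frames and canonicity -/

/-- The Boolean value of a formula when variables, boxed formulae and diamond formulae get the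
truth values prescribed by `v`. -/
def propValue (v : MLFormula → Prop) : MLFormula → Prop
  | var p => v (var p)
  | bot => False
  | top => True
  | neg φ => ¬ φ.propValue v
  | or φ ψ => φ.propValue v ∨ ψ.propValue v
  | and φ ψ => φ.propValue v ∧ ψ.propValue v
  | dia φ => v (dia φ)
  | box φ => v (box φ)

/-- (Substitution instances of) propositional tautologies. -/
def IsTautology (φ : MLFormula) : Prop := ∀ v : MLFormula → Prop, φ.propValue v

/-- Conjunction of a finite list of formulae. -/
def conj : List MLFormula → MLFormula
  | [] => top
  | φ :: l => φ.and (conj l)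

end MLFormula

/-- Normal modal logics, as sets of formulae. -/
structure IsNormalLogic (Λ : Set MLFormula) : Prop where
  taut : ∀ φ, φ.IsTautology → φ ∈ Λ
  distr : ∀ φ ψ : MLFormula, ((φ.imp ψ).box.imp (φ.box.imp ψ.box)) ∈ Λ
  dual : ∀ φ : MLFormula, (φ.dia.iff φ.neg.box.neg) ∈ Λ
  mp : ∀ φ ψ : MLFormula, φ.imp ψ ∈ Λ → φ ∈ Λ → ψ ∈ Λ
  nec : ∀ φ : MLFormula, φ ∈ Λ → φ.box ∈ Λ
  subst : ∀ (φ : MLFormula) (σ : ℕ → MLFormula), φ ∈ Λ → φ.subst σ ∈ Λ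

/-- `Γ` is `Λ`-consistent: the negation of no finite conjunction of members of `Γ` is in `Λ`. -/
def LogicConsistent (Λ Γ : Set MLFormula) : Prop :=
  ∀ l : List MLFormula, (∀ φ ∈ l, φ ∈ Γ) → (MLFormula.conj l).neg ∉ Λ

/-- The worlds of the canonical frame of `Λ`: the maximal `Λ`-consistent sets of formulae. -/
def CanonicalWorld (Λ : Set MLFormula) : Type :=
  {Γ : Set MLFormula // LogicConsistent Λ Γ ∧ ∀ Δ, LogicConsistent Λ Δ → Γ ⊆ Δ → Δ = Γ}

/-- The accessibility relation of the canonical frame of `Λ`. -/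
def canonicalRel (Λ : Set MLFormula) (Γ Δ : CanonicalWorld Λ) : Prop :=
  ∀ φ : MLFormula, φ.box ∈ Γ.1 → φ ∈ Δ.1

/-- `φ` is canonical: it is valid on the canonical frame of every normal modal logic that
contains it. (If `Λ` is inconsistent there are no worlds and the condition is void.) -/
def MLFormula.IsCanonical (φ : MLFormula) : Prop :=
  ∀ Λ : Set MLFormula, IsNormalLogic Λ → φ ∈ Λ → φ.ValidOn (canonicalRel Λ)

/-! ### Monadic inductive formulae -/

/-- Box-forms of the placeholder `♯`. -/
inductive BoxForm : Type
  | sharp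
  | box (B : BoxForm)
  | imp (A : MLFormula) (hA : A.IsPositive) (B : BoxForm)

namespace BoxForm

/-- The box-formula `B(p)` with head `p`. -/
def app : BoxForm → ℕ → MLFormula
  | sharp, p => .var p
  | box B, p => (B.app p).box
  | imp A _ B, p => A.imp (B.app p)

/-- The variables with an inessential occurrence in `B(p)`. -/
def inessential : BoxForm → Set ℕ
  | sharp => ∅
  | box B => B.inessential
  | imp A _ B => A.vars ∪ B.inessential

end BoxForm

/-- The formulae built from `⊤`, `⊥`, positive formulae and negations of box-formulae `B(p)` with
`(B, p)` in the set `𝓑`, by conjunctions, disjunctions and boxes. -/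
inductive RegularOver (𝓑 : Set (BoxForm × ℕ)) : MLFormula → Prop
  | top : RegularOver 𝓑 .top
  | bot : RegularOver 𝓑 .bot
  | pos (φ : MLFormula) : φ.IsPositive → RegularOver 𝓑 φ
  | negBox (B : BoxForm) (p : ℕ) : (B, p) ∈ 𝓑 → RegularOver 𝓑 (B.app p).neg
  | and (φ ψ : MLFormula) : RegularOver 𝓑 φ → RegularOver 𝓑 ψ → RegularOver 𝓑 (φ.and ψ)
  | or (φ ψ : MLFormula) : RegularOver 𝓑 φ → RegularOver 𝓑 ψ → RegularOver 𝓑 (φ.or ψ)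
  | box (φ : MLFormula) : RegularOver 𝓑 φ → RegularOver 𝓑 φ.box

/-- The heads of a set of box-formulae: the vertices of its dependency digraph. -/
def heads (𝓑 : Set (BoxForm × ℕ)) : Set ℕ := {p | ∃ B, (B, p) ∈ 𝓑}

/-- The edges of the dependency digraph: from `p` to `q` if both are heads and `p` occurs as an
inessential variable in some box-formula of `𝓑` with head `q`. -/
def DependencyEdge (𝓑 : Set (BoxForm × ℕ)) (p q : ℕ) : Prop :=
  p ∈ heads 𝓑 ∧ q ∈ heads 𝓑 ∧ ∃ B, (B, q) ∈ 𝓑 ∧ p ∈ B.inessential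

/-- The dependency digraph has no oriented cycles, including loops. -/
def AcyclicDependency (𝓑 : Set (BoxForm × ℕ)) : Prop :=
  ∀ p, ¬ Relation.TransGen (DependencyEdge 𝓑) p p

/-- The box-formulae that occur as subformulae of `φ`. -/
def boxFormulaeOf (φ : MLFormula) : Set (BoxForm × ℕ) := {b | b.1.app b.2 ∈ φ.subformulae}

/-- Monadic inductive formulae: built up as regular formulae from positive formulae and negations
of box-formulae from a set `𝓑` (of box-formulae occurring in `φ`) whose dependency digraph is
acyclic. Only the box-formulae whose negations are used in the construction have to be in `𝓑`, so
that for instance the disjunction `¬p ∨ □p` of the negated box-formula `¬p` and the positive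
formula `□p` qualifies, although it can also be read as the box-formula `p → □p`. -/
def IsMonadicInductive (φ : MLFormula) : Prop :=
  ∃ 𝓑 ⊆ boxFormulaeOf φ, RegularOver 𝓑 φ ∧ AcyclicDependency 𝓑

theorem MLFormula.self_mem_subformulae (φ : MLFormula) : φ ∈ φ.subformulae := by
  cases φ <;> simp [MLFormula.subformulae]

theorem RegularOver.mono {𝓑 𝓒 : Set (BoxForm × ℕ)} {φ : MLFormula} (h : RegularOver 𝓑 φ)
    (h𝓒 : 𝓑 ∩ boxFormulaeOf φ ⊆ 𝓒) : RegularOver 𝓒 φ := by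
  induction h with
  | top => exact .top
  | bot => exact .bot
  | pos φ h => exact .pos φ h
  | negBox B p h =>
    refine .negBox B p (h𝓒 ⟨h, ?_⟩)
    exact Set.mem_insert_of_mem _ (MLFormula.self_mem_subformulae _)
  | and φ ψ _ _ ih₁ ih₂ =>
    exact .and φ ψ
      (ih₁ fun b hb => h𝓒 ⟨hb.1, Set.mem_insert_of_mem _ (Or.inl hb.2)⟩)
      (ih₂ fun b hb => h𝓒 ⟨hb.1, Set.mem_insert_of_mem _ (Or.inr hb.2)⟩)
  | or φ ψ _ _ ih₁ ih₂ =>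
    exact .or φ ψ
      (ih₁ fun b hb => h𝓒 ⟨hb.1, Set.mem_insert_of_mem _ (Or.inl hb.2)⟩)
      (ih₂ fun b hb => h𝓒 ⟨hb.1, Set.mem_insert_of_mem _ (Or.inr hb.2)⟩)
  | box φ _ ih =>
    exact .box φ (ih fun b hb => h𝓒 ⟨hb.1, Set.mem_insert_of_mem _ hb.2⟩)

/-- In particular, a regular formula is monadic inductive if the dependency digraph of the set of
all box-formulae that occur as its subformulae is acyclic. -/
theorem IsMonadicInductive.of_acyclic_boxFormulaeOf {φ : MLFormula}
    (h : RegularOver Set.univ φ) (hac : AcyclicDependency (boxFormulaeOf φ)) :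
    IsMonadicInductive φ :=
  ⟨boxFormulaeOf φ, subset_rfl, h.mono fun _ hb => hb.2, hac⟩

/-!
A refutation of a regular formula `φ` at a world `w` reduces to finitely many constraints:
box-formulae that have to be true at certain worlds `x i` and positive formulae that have to be
false at certain worlds (`RegularOver.exists_refutation_shapes`). Which box-formulae can occur
together depends on `φ` only. The truth of `B(p)` at `x` says that the value of the head `p`
includes a set `B.reach R V {x}`, which is monotone in the values of the inessential variables. So
there is a least valuation that satisfies the box-formulae, and it falsifies every positive formula
that some valuation satisfying them falsifies. Since the dependency digraph is acyclic, the
variables can be ranked (`AcyclicDependency.exists_rank`), and the least valuation is reached from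
the empty one after finitely many steps (`leastValuation`, `holds_leastValuation`).

First-order definability: the least valuation is definable by a first-order formula with the `x i`
as parameters, uniformly in the frame, and `φ` is valid at `w` iff it is true there under all least
valuations for its finitely many families of box-formulae.

Canonicity: the canonical frame is a descriptive frame whose clopen sets are the sets
`{Γ | ψ ∈ Γ}`, so by the truth lemma a formula in the logic cannot be refuted under a clopen
valuation. It therefore suffices to turn any refutation of `φ` into one under a clopen valuation
(`IsMonadicInductive.exists_clopen_valuation`). The least valuation has closed values. By Esakia's
lemma (`IsDescriptive.exists_clopen_valuation_not_holds`) its values can be enlarged to clopen sets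
`O 0` such that the positive formulae remain false, and then, given `O n`, to smaller clopen sets
`O (n + 1)` such that the box-formulae are true with their heads interpreted by `O n` and their
inessential variables by `O (n + 1)`. If all ranks are below `N`, interpreting each variable `q` of
rank `k` by `O (N - k) q` satisfies all constraints.
-/

/-! ### Monotonicity and the sets reached by box-forms -/

/-- Truth is monotone in the variables that occur positively and antitone in those that occur
negatively. -/
theorem MLFormula.Holds.mono {W : Type*} {R : W → W → Prop} {φ : MLFormula} {V V' : ℕ → Set W}
    {x : W} (h : φ.Holds R V x) (hpos : ∀ q ∈ φ.occ true, V q ⊆ V' q)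
    (hneg : ∀ q ∈ φ.occ false, V' q ⊆ V q) : φ.Holds R V' x := by
  induction φ generalizing V V' x with
  | var p => exact hpos p ⟨rfl, rfl⟩ h
  | bot => exact h
  | top => trivial
  | neg φ ih => exact fun h' => h (ih h' hneg hpos)
  | or φ ψ ih₁ ih₂ =>
    exact h.imp
      (fun h => ih₁ h (fun q hq => hpos q (.inl hq)) (fun q hq => hneg q (.inl hq)))
      (fun h => ih₂ h (fun q hq => hpos q (.inr hq)) (fun q hq => hneg q (.inr hq)))
  | and φ ψ ih₁ ih₂ =>
    exact h.imp
      (fun h => ih₁ h (fun q hq => hpos q (.inl hq)) (fun q hq => hneg q (.inl hq)))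
      (fun h => ih₂ h (fun q hq => hpos q (.inr hq)) (fun q hq => hneg q (.inr hq)))
  | dia φ ih =>
    obtain ⟨y, hy, h⟩ := h
    exact ⟨y, hy, ih h hpos hneg⟩
  | box φ ih => exact fun y hy => ih (h y hy) hpos hneg

theorem MLFormula.IsPositive.holds_mono {W : Type*} {R : W → W → Prop} {φ : MLFormula}
    (hφ : φ.IsPositive) {V V' : ℕ → Set W} {x : W} (h : φ.Holds R V x)
    (hV : ∀ q ∈ φ.vars, V q ⊆ V' q) : φ.Holds R V' x :=
  h.mono (fun q hq => hV q (.inl hq)) (fun q hq => by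
    rw [hφ] at hq
    exact hq.elim)

namespace BoxForm

theorem occ_true_app (B : BoxForm) (p : ℕ) : (B.app p).occ true = {p} := by
  induction B with
  | sharp => simp [app, MLFormula.occ]
  | box B ih => exact ih
  | imp A hA B ih =>
    have hA' : A.occ false = ∅ := hA
    simp [app, MLFormula.imp, MLFormula.occ, ih, hA']

theorem occ_false_app_subset (B : BoxForm) (p : ℕ) : (B.app p).occ false ⊆ B.inessential := by
  induction B with
  | sharp => simp [app, MLFormula.occ]
  | box B ih => exact ih
  | imp A hA B ih =>
    exact Set.union_subset_union (Set.subset_union_left (s := A.occ true)) ih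

variable {W : Type*} {R : W → W → Prop}

/-- The set that the head of `B(p)` has to include for `B(p)` to be true throughout `S`, when the
inessential variables are interpreted by `V`. -/
def reach (R : W → W → Prop) (V : ℕ → Set W) : BoxForm → Set W → Set W
  | sharp, S => S
  | box B, S => B.reach R V {y | ∃ x ∈ S, R x y}
  | imp A _ B, S => B.reach R V {x | x ∈ S ∧ A.Holds R V x}

theorem reach_subset_iff (V : ℕ → Set W) (B : BoxForm) (p : ℕ) (S : Set W) :
    B.reach R V S ⊆ V p ↔ ∀ x ∈ S, (B.app p).Holds R V x := by
  induction B generalizing S with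
  | sharp => exact Iff.rfl
  | box B ih =>
    refine (ih _).trans ⟨fun h x hx y hy => h y ⟨x, hx, hy⟩, ?_⟩
    rintro h y ⟨x, hx, hy⟩
    exact h x hx y hy
  | imp A hA B ih =>
    refine (ih _).trans ⟨fun h x hx => ?_, ?_⟩
    · by_cases hAx : A.Holds R V x
      · exact .inr (h x ⟨hx, hAx⟩)
      · exact .inl hAx
    · rintro h x ⟨hx, hAx⟩
      exact (h x hx).resolve_left fun hn => hn hAx

theorem reach_mono {V V' : ℕ → Set W} {B : BoxForm} {S S' : Set W}
    (hV : ∀ q ∈ B.inessential, V q ⊆ V' q) (hS : S ⊆ S') :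
    B.reach R V S ⊆ B.reach R V' S' := by
  induction B generalizing S S' with
  | sharp => exact hS
  | box B ih => exact ih hV fun y ⟨x, hx, hy⟩ => ⟨x, hS hx, hy⟩
  | imp A hA B ih =>
    exact ih (fun q hq => hV q (.inr hq))
      fun x hx => ⟨hS hx.1, hA.holds_mono hx.2 fun q hq => hV q (.inl hq)⟩

end BoxForm

/-! ### Refuting regular formulae -/

/-- A refutation of a regular formula at `w` rests on finitely many constraints: box-formulae that
are true at certain worlds and positive formulae that are false at certain worlds. The list of the
box-formulae involved ranges over a finite set that depends on the formula alone. -/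
theorem RegularOver.exists_refutation_shapes {𝓑 : Set (BoxForm × ℕ)} {φ : MLFormula}
    (h : RegularOver 𝓑 φ) :
    ∃ 𝓢 : Set (List (BoxForm × ℕ)), 𝓢.Finite ∧ (∀ S ∈ 𝓢, ∀ b ∈ S, b ∈ 𝓑) ∧
      ∀ (W : Type u) (R : W → W → Prop) (V : ℕ → Set W) (w : W), ¬ φ.Holds R V w →
        ∃ (X : List (W × (BoxForm × ℕ))) (Y : List (W × MLFormula)),
          X.map Prod.snd ∈ 𝓢 ∧ (∀ y ∈ Y, y.2.IsPositive) ∧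
          (∀ x ∈ X, (x.2.1.app x.2.2).Holds R V x.1) ∧ (∀ y ∈ Y, ¬ y.2.Holds R V y.1) ∧
          ∀ V' : ℕ → Set W, (∀ x ∈ X, (x.2.1.app x.2.2).Holds R V' x.1) →
            (∀ y ∈ Y, ¬ y.2.Holds R V' y.1) → ¬ φ.Holds R V' w := by
  induction h with
  | top => exact ⟨∅, Set.finite_empty, by simp, fun W R V w h => (h trivial).elim⟩
  | bot => exact ⟨{[]}, Set.finite_singleton _, by simp, fun W R V w _ =>
      ⟨[], [], by simp, by simp, by simp, by simp, fun _ _ _ h => h⟩⟩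
  | pos φ hφ => exact ⟨{[]}, Set.finite_singleton _, by simp, fun W R V w hw =>
      ⟨[], [(w, φ)], by simp, by simpa using hφ, by simp, by simpa using hw,
        fun V' _ h => by simpa using h⟩⟩
  | negBox B p hB =>
    exact ⟨{[(B, p)]}, Set.finite_singleton _, by simpa using hB, fun W R V w hw =>
      ⟨[(w, (B, p))], [], by simp, by simp, by simpa using not_not.1 hw, by simp,
        fun V' h _ => not_not.2 (by simpa using h)⟩⟩
  | and φ ψ _ _ ih₁ ih₂ =>
    obtain ⟨𝓢₁, hf₁, hs₁, h₁⟩ := ih₁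
    obtain ⟨𝓢₂, hf₂, hs₂, h₂⟩ := ih₂
    refine ⟨𝓢₁ ∪ 𝓢₂, hf₁.union hf₂, fun S hS => hS.elim (hs₁ S) (hs₂ S), fun W R V w hw => ?_⟩
    rcases not_and_or.1 hw with hw | hw
    · obtain ⟨X, Y, hX, hY, hXV, hYV, hr⟩ := h₁ W R V w hw
      exact ⟨X, Y, .inl hX, hY, hXV, hYV, fun V' a b c => hr V' a b c.1⟩
    · obtain ⟨X, Y, hX, hY, hXV, hYV, hr⟩ := h₂ W R V w hw
      exact ⟨X, Y, .inr hX, hY, hXV, hYV, fun V' a b c => hr V' a b c.2⟩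
  | or φ ψ _ _ ih₁ ih₂ =>
    obtain ⟨𝓢₁, hf₁, hs₁, h₁⟩ := ih₁
    obtain ⟨𝓢₂, hf₂, hs₂, h₂⟩ := ih₂
    refine ⟨Set.image2 (· ++ ·) 𝓢₁ 𝓢₂, hf₁.image2 _ hf₂, ?_, fun W R V w hw => ?_⟩
    · rintro _ ⟨S₁, hS₁, S₂, hS₂, rfl⟩ b hb
      exact (List.mem_append.1 hb).elim (hs₁ S₁ hS₁ b) (hs₂ S₂ hS₂ b)
    · obtain ⟨hw₁, hw₂⟩ := not_or.1 hw
      obtain ⟨X₁, Y₁, hX₁, hY₁, hXV₁, hYV₁, hr₁⟩ := h₁ W R V w hw₁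
      obtain ⟨X₂, Y₂, hX₂, hY₂, hXV₂, hYV₂, hr₂⟩ := h₂ W R V w hw₂
      refine ⟨X₁ ++ X₂, Y₁ ++ Y₂, ⟨_, hX₁, _, hX₂, List.map_append.symm⟩, ?_, ?_, ?_, ?_⟩
      · exact fun y hy => (List.mem_append.1 hy).elim (hY₁ y) (hY₂ y)
      · exact fun y hy => (List.mem_append.1 hy).elim (hXV₁ y) (hXV₂ y)
      · exact fun y hy => (List.mem_append.1 hy).elim (hYV₁ y) (hYV₂ y)
      · rintro V' a b (c | c)
        · exact hr₁ V' (fun x hx => a x (List.mem_append_left _ hx))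
            (fun x hx => b x (List.mem_append_left _ hx)) c
        · exact hr₂ V' (fun x hx => a x (List.mem_append_right _ hx))
            (fun x hx => b x (List.mem_append_right _ hx)) c
  | box φ _ ih =>
    obtain ⟨𝓢, hf, hs, h⟩ := ih
    refine ⟨𝓢, hf, hs, fun W R V w hw => ?_⟩
    obtain ⟨v, hv⟩ := not_forall.1 hw
    obtain ⟨hwv, hv⟩ := Classical.not_imp.1 hv
    obtain ⟨X, Y, hX, hY, hXV, hYV, hr⟩ := h W R V v hv
    exact ⟨X, Y, hX, hY, hXV, hYV, fun V' a b c => hr V' a b (c v hwv)⟩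

/-! ### Ranks of variables -/

theorem AcyclicDependency.mono {𝓑 𝓒 : Set (BoxForm × ℕ)} (h : AcyclicDependency 𝓑)
    (h𝓒 : 𝓒 ⊆ 𝓑) : AcyclicDependency 𝓒 := fun p hp =>
  h p <| Relation.TransGen.mono (fun _ _ ⟨⟨B, hB⟩, ⟨B', hB'⟩, C, hC, hq⟩ =>
    ⟨⟨B, h𝓒 hB⟩, ⟨B', h𝓒 hB'⟩, C, h𝓒 hC, hq⟩) _ _ hp

/-- If the dependency digraph is finite and acyclic, the variables can be ranked in such a way that
the head of each box-formula has a higher rank than its inessential variables: a variable that is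
not a head gets rank `0`, a head one more than the number of variables it depends on. -/
theorem AcyclicDependency.exists_rank {𝓑 : Set (BoxForm × ℕ)} (h : AcyclicDependency 𝓑)
    (hfin : 𝓑.Finite) :
    ∃ (r : ℕ → ℕ) (N : ℕ), (∀ p, r p < N) ∧
      ∀ b ∈ 𝓑, ∀ q ∈ b.1.inessential, r q < r b.2 := by
  classical
  have hheads : (heads 𝓑).Finite :=
    (hfin.image Prod.snd).subset fun p ⟨B, hB⟩ => ⟨(B, p), hB, rfl⟩
  have hsub : ∀ p, {q | Relation.TransGen (DependencyEdge 𝓑) q p} ⊆ heads 𝓑 := fun p q hq => by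
    obtain ⟨_, hq, _⟩ := Relation.TransGen.head'_iff.1 hq
    exact hq.1
  refine ⟨fun p => if p ∈ heads 𝓑 then
    {q | Relation.TransGen (DependencyEdge 𝓑) q p}.ncard + 1 else 0,
    (heads 𝓑).ncard + 2, fun p => ?_, ?_⟩
  · have := Set.ncard_le_ncard (hsub p) hheads
    dsimp only
    split_ifs <;> omega
  · rintro ⟨B, p⟩ hB q hq
    have hp : p ∈ heads 𝓑 := ⟨B, hB⟩
    dsimp only
    rw [if_pos hp]
    split_ifs with hqh
    · have he : DependencyEdge 𝓑 q p := ⟨hqh, hp, B, hB, hq⟩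
      refine Nat.succ_lt_succ (Set.ncard_lt_ncard ?_ (hheads.subset (hsub p)))
      refine ⟨fun s hs => hs.tail he, fun hle => h q (hle (Relation.TransGen.single he))⟩
    · exact Nat.succ_pos _

/-! ### Least valuations -/

section LeastValuation

variable {W : Type*} {ι : Type*}

/-- One step towards the least valuation that makes the box-formula `b i` true at the world `x i`
for all `i`. -/
def valuationStep (R : W → W → Prop) (b : ι → BoxForm × ℕ) (x : ι → W) (V : ℕ → Set W) :
    ℕ → Set W :=
  fun p => {y | ∃ i, (b i).2 = p ∧ y ∈ (b i).1.reach R V {x i}}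

/-- The `n`-th approximation, from the empty valuation, to the least valuation that makes the
box-formula `b i` true at the world `x i` for all `i`. -/
def leastValuation (R : W → W → Prop) (b : ι → BoxForm × ℕ) (x : ι → W) : ℕ → ℕ → Set W
  | 0 => fun _ => ∅
  | n + 1 => valuationStep R b x (leastValuation R b x n)

variable {R : W → W → Prop} {b : ι → BoxForm × ℕ} {x : ι → W}

theorem leastValuation_subset {V : ℕ → Set W}
    (hV : ∀ i, ((b i).1.app (b i).2).Holds R V (x i)) (n p : ℕ) :
    leastValuation R b x n p ⊆ V p := by
  induction n generalizing p with
  | zero => exact Set.empty_subset _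
  | succ n ih =>
    rintro y ⟨i, rfl, hy⟩
    refine ((b i).1.reach_subset_iff V (b i).2 {x i}).2 ?_
      (BoxForm.reach_mono (fun q _ => ih q) subset_rfl hy)
    rintro _ rfl
    exact hV i

variable {r : ℕ → ℕ} (hr : ∀ i, ∀ q ∈ (b i).1.inessential, r q < r (b i).2)
include hr

theorem leastValuation_succ_eq {n p : ℕ} (hp : r p < n) :
    leastValuation R b x (n + 1) p = leastValuation R b x n p := by
  induction n generalizing p with
  | zero => omega
  | succ n ih =>
    ext y
    refine exists_congr fun i => and_congr_right fun hi => ?_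
    have hq : ∀ q ∈ (b i).1.inessential,
        leastValuation R b x (n + 1) q = leastValuation R b x n q := fun q hq =>
      ih (by have := hr i q hq; rw [hi] at this; omega)
    exact ⟨fun h => BoxForm.reach_mono (fun q h => (hq q h).subset) subset_rfl h,
      fun h => BoxForm.reach_mono (fun q h => (hq q h).superset) subset_rfl h⟩

theorem holds_leastValuation {N : ℕ} (hN : ∀ p, r p < N) (i : ι) :
    ((b i).1.app (b i).2).Holds R (leastValuation R b x N) (x i) := by
  refine ((b i).1.reach_subset_iff _ _ {x i}).1 (fun y hy => ?_) _ rfl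
  rw [← leastValuation_succ_eq hr (hN _)]
  exact ⟨i, rfl, hy⟩

end LeastValuation

/-! ### First-order definability of the least valuations -/

/-- A property of a world `w` of a frame, with parameters `e` in the frame, is uniformly definable
if a single first-order formula defines it in all frames; the variable `Sum.inr ()` of the formula
stands for `w`. -/
def UniformlyDefinable {ι : Type} (P : ∀ W : Type u, (W → W → Prop) → (ι → W) → W → Prop) : Prop :=
  ∃ α : frameLanguage.Formula (ι ⊕ Unit), ∀ (W : Type u) (R : W → W → Prop) (e : ι → W) (w : W),
    P W R e w ↔ (letI := frameStructure R; α.Realize (Sum.elim e fun _ => w))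

namespace UniformlyDefinable

variable {ι : Type} {P Q : ∀ W : Type u, (W → W → Prop) → (ι → W) → W → Prop}

theorem false : UniformlyDefinable.{u} (ι := ι) fun _ _ _ _ => False :=
  ⟨⊥, fun _ _ _ _ => Iff.rfl⟩

theorem not (hP : UniformlyDefinable P) : UniformlyDefinable fun W R e w => ¬ P W R e w := by
  obtain ⟨α, hα⟩ := hP
  exact ⟨α.not, fun W R e w => not_congr (hα W R e w)⟩

theorem and (hP : UniformlyDefinable P) (hQ : UniformlyDefinable Q) :
    UniformlyDefinable fun W R e w => P W R e w ∧ Q W R e w := by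
  obtain ⟨α, hα⟩ := hP
  obtain ⟨β, hβ⟩ := hQ
  refine ⟨α ⊓ β, fun W R e w => ?_⟩
  let := frameStructure R
  exact (and_congr (hα W R e w) (hβ W R e w)).trans
    FirstOrder.Language.Formula.realize_inf.symm

theorem congr (hP : UniformlyDefinable P) (h : ∀ W R e w, Q W R e w ↔ P W R e w) :
    UniformlyDefinable Q := by
  obtain ⟨α, hα⟩ := hP
  exact ⟨α, fun W R e w => (h W R e w).trans (hα W R e w)⟩

theorem or (hP : UniformlyDefinable P) (hQ : UniformlyDefinable Q) :
    UniformlyDefinable fun W R e w => P W R e w ∨ Q W R e w :=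
  (hP.not.and hQ.not).not.congr fun _ _ _ _ => or_iff_not_and_not

theorem eq_param (i : ι) : UniformlyDefinable.{u} (ι := ι) fun _ _ e w => w = e i := by
  refine ⟨(FirstOrder.Language.Term.var (Sum.inr ())).equal (.var (Sum.inl i)),
    fun W R e w => ?_⟩
  let := frameStructure R
  simp [FirstOrder.Language.Formula.realize_equal]

theorem exists_rel (hP : UniformlyDefinable P) :
    UniformlyDefinable fun W R e w => ∃ v, R w v ∧ P W R e v := by
  obtain ⟨α, hα⟩ := hP
  let r : frameLanguage.Relations 2 := FrameRel.R
  refine ⟨((r.formula₂ (.var (Sum.inl (Sum.inr ()))) (.var (Sum.inr ()))) ⊓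
    α.relabel (Sum.map Sum.inl id)).iExs Unit, fun W R e w => ?_⟩
  let := frameStructure R
  rw [FirstOrder.Language.Formula.realize_iExs]
  simp only [hα, FirstOrder.Language.Formula.realize_inf,
    FirstOrder.Language.Formula.realize_relabel, FirstOrder.Language.Formula.realize_rel₂]
  constructor
  · rintro ⟨v, hv, h⟩
    refine ⟨fun _ => v, hv, ?_⟩
    convert h using 1
    ext i
    rcases i with i | i <;> rfl
  · rintro ⟨f, hv, h⟩
    refine ⟨f (), hv, ?_⟩
    convert h using 1
    ext i
    rcases i with i | i <;> rfl

theorem exists_rel_inv (hP : UniformlyDefinable P) :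
    UniformlyDefinable fun W R e w => ∃ v, P W R e v ∧ R v w := by
  obtain ⟨α, hα⟩ := hP
  let r : frameLanguage.Relations 2 := FrameRel.R
  refine ⟨(α.relabel (Sum.map Sum.inl id) ⊓
    (r.formula₂ (.var (Sum.inr ())) (.var (Sum.inl (Sum.inr ()))))).iExs Unit,
    fun W R e w => ?_⟩
  let := frameStructure R
  rw [FirstOrder.Language.Formula.realize_iExs]
  simp only [hα, FirstOrder.Language.Formula.realize_inf,
    FirstOrder.Language.Formula.realize_relabel, FirstOrder.Language.Formula.realize_rel₂]
  constructor
  · rintro ⟨v, h, hv⟩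
    refine ⟨fun _ => v, ?_, hv⟩
    convert h using 1
    ext i
    rcases i with i | i <;> rfl
  · rintro ⟨f, h, hv⟩
    refine ⟨f (), ?_, hv⟩
    convert h using 1
    ext i
    rcases i with i | i <;> rfl

theorem exists_finite {κ : Type} [Finite κ]
    {P : κ → ∀ W : Type u, (W → W → Prop) → (ι → W) → W → Prop}
    (hP : ∀ k, UniformlyDefinable (P k)) : UniformlyDefinable fun W R e w => ∃ k, P k W R e w := by
  choose α hα using hP
  refine ⟨FirstOrder.Language.Formula.iSup α, fun W R e w => ?_⟩
  let := frameStructure R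
  rw [FirstOrder.Language.Formula.realize_iSup]
  exact exists_congr fun k => hα k W R e w

/-- The standard translation, for a valuation by uniformly definable sets. -/
theorem holds {V : ∀ W : Type u, (W → W → Prop) → (ι → W) → ℕ → Set W}
    (hV : ∀ p, UniformlyDefinable fun W R e w => w ∈ V W R e p) (φ : MLFormula) :
    UniformlyDefinable fun W R e w => φ.Holds R (V W R e) w := by
  induction φ with
  | var p => exact hV p
  | bot => exact false
  | top => exact false.not.congr fun _ _ _ _ => by simp [MLFormula.Holds]
  | neg φ ih => exact ih.not
  | or φ ψ ih₁ ih₂ => exact ih₁.or ih₂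
  | and φ ψ ih₁ ih₂ => exact ih₁.and ih₂
  | dia φ ih => exact ih.exists_rel
  | box φ ih =>
    exact ih.not.exists_rel.not.congr fun _ _ _ _ => by simp [MLFormula.Holds]

theorem reach {V : ∀ W : Type u, (W → W → Prop) → (ι → W) → ℕ → Set W}
    (hV : ∀ p, UniformlyDefinable fun W R e w => w ∈ V W R e p) (B : BoxForm)
    {S : ∀ W : Type u, (W → W → Prop) → (ι → W) → Set W}
    (hS : UniformlyDefinable fun W R e w => w ∈ S W R e) :
    UniformlyDefinable fun W R e w => w ∈ B.reach R (V W R e) (S W R e) := by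
  induction B generalizing S with
  | sharp => exact hS
  | box B ih => exact ih hS.exists_rel_inv
  | imp A _ B ih => exact ih (hS.and (holds hV A))

theorem leastValuation [Finite ι] (b : ι → BoxForm × ℕ) (n p : ℕ) :
    UniformlyDefinable.{u} fun _ R e w => w ∈ leastValuation R b e n p := by
  induction n generalizing p with
  | zero => exact false
  | succ n ih =>
    refine exists_finite fun i => ?_
    by_cases hi : (b i).2 = p
    · exact (reach ih (b i).1 (eq_param i)).congr fun _ _ _ _ => and_iff_right hi
    · exact false.congr fun _ _ _ _ => by simp [hi]

/-- The parameters of a uniformly definable property can be quantified away. -/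
theorem exists_formula_forall [Finite ι] (hP : UniformlyDefinable P) :
    ∃ α : frameLanguage.Formula (Fin 1), ∀ (W : Type u) (R : W → W → Prop) (w : W),
      (∀ e, P W R e w) ↔ FrameSatisfies R α w := by
  obtain ⟨α, hα⟩ := hP
  refine ⟨(α.relabel (Sum.elim Sum.inr fun _ => Sum.inl 0)).iAlls ι, fun W R w => ?_⟩
  let := frameStructure R
  rw [FrameSatisfies, FirstOrder.Language.Formula.realize_iAlls]
  refine forall_congr' fun e => ?_
  rw [hα, FirstOrder.Language.Formula.realize_relabel]
  refine iff_of_eq (congrArg _ ?_)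
  ext i
  rcases i with i | i <;> rfl

end UniformlyDefinable

/-- A refutation of a regular formula over an acyclic set of box-formulae gives rise to
box-formulae `b i`, from a finite set of possible families `b`, and worlds `x i` such that the
formula is refuted by all valuations that make every `b i` true at `x i` and falsify a certain
finite set of positive formulae at certain worlds. The positive formulae are false under the
approximations to the least valuation for `b` and `x`, since these are included in the given
refuting valuation. The ranks ensure that the least valuation is reached after `N` steps. -/
theorem IsMonadicInductive.exists_shapes {φ : MLFormula} (hφ : IsMonadicInductive φ) :
    ∃ 𝓢 : Set (List (BoxForm × ℕ)), 𝓢.Finite ∧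
      (∀ S ∈ 𝓢, ∃ (r : ℕ → ℕ) (N : ℕ), (∀ p, r p < N) ∧
        ∀ i, ∀ q ∈ (S.get i).1.inessential, r q < r (S.get i).2) ∧
      ∀ (W : Type u) (R : W → W → Prop) (V : ℕ → Set W) (w : W), ¬ φ.Holds R V w →
        ∃ S ∈ 𝓢, ∃ (x : Fin S.length → W) (Y : List (W × MLFormula)),
          (∀ y ∈ Y, y.2.IsPositive) ∧
          (∀ n, ∀ y ∈ Y, ¬ y.2.Holds R (leastValuation R S.get x n) y.1) ∧
          ∀ V' : ℕ → Set W, (∀ i, ((S.get i).1.app (S.get i).2).Holds R V' (x i)) →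
            (∀ y ∈ Y, ¬ y.2.Holds R V' y.1) → ¬ φ.Holds R V' w := by
  obtain ⟨𝓑, -, hreg, hac⟩ := hφ
  obtain ⟨𝓢, hfin, hsub, h⟩ := hreg.exists_refutation_shapes.{u}
  refine ⟨𝓢, hfin, fun S hS => ?_, fun W R V w hw => ?_⟩
  · obtain ⟨r, N, hN, hr⟩ := (hac.mono (hsub S hS)).exists_rank (List.finite_toSet S)
    exact ⟨r, N, hN, fun i => hr _ (List.get_mem S i)⟩
  · obtain ⟨X, Y, hX, hY, hXV, hYV, hr⟩ := h W R V w hw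
    have key : ∀ V' : ℕ → Set W, (∀ x ∈ X, (x.2.1.app x.2.2).Holds R V' x.1) ↔
        ∀ i : Fin (X.map Prod.snd).length,
          (((X.map Prod.snd).get i).1.app ((X.map Prod.snd).get i).2).Holds R V'
            (X.get (i.cast (List.length_map _))).1 := fun V' => by
      rw [List.forall_mem_iff_get,
        ← (finCongr (List.length_map (as := X) Prod.snd)).forall_congr_right]
      simp
    refine ⟨_, hX, fun i => (X.get (i.cast (List.length_map _))).1, Y, hY, fun n y hy hn => ?_,
      fun V' hV' hYV' => hr V' ((key V').2 hV') hYV'⟩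
    exact hYV y hy <| (hY y hy).holds_mono hn
      fun q _ => leastValuation_subset ((key V).1 hXV) n q

/-- A monadic inductive formula is valid at a world iff it is true there under the least
valuations, and these are given by finitely many first-order definable families. -/
theorem IsMonadicInductive.locallyFirstOrderDefinable {φ : MLFormula}
    (hφ : IsMonadicInductive φ) : MLFormula.LocallyFirstOrderDefinable.{u} φ := by
  obtain ⟨𝓢, hfin, hrank, h⟩ := hφ.exists_shapes.{u}
  choose r N hN hr using hrank
  have hdef : ∀ S : 𝓢, ∃ α : frameLanguage.Formula (Fin 1),
      ∀ (W : Type u) (R : W → W → Prop) (w : W),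
        (∀ x : Fin S.1.length → W,
          φ.Holds R (leastValuation R S.1.get x (N S.1 S.2)) w) ↔ FrameSatisfies R α w := fun S =>
    (UniformlyDefinable.holds
      (UniformlyDefinable.leastValuation S.1.get (N S.1 S.2)) φ).exists_formula_forall
  choose α hα using hdef
  have := hfin.to_subtype
  refine ⟨FirstOrder.Language.Formula.iInf α, fun W _ R w => ?_⟩
  have hinf : FrameSatisfies R (FirstOrder.Language.Formula.iInf α) w ↔
      ∀ S, FrameSatisfies R (α S) w := by
    let := frameStructure R
    exact FirstOrder.Language.Formula.realize_iInf
  rw [hinf]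
  refine ⟨fun hv S => (hα S W R w).1 fun x => hv _, fun hS V => ?_⟩
  by_contra hw
  obtain ⟨S, hS𝓢, x, Y, -, hY, hV'⟩ := h W R V w hw
  exact hV' _ (holds_leastValuation (hr S hS𝓢) (hN S hS𝓢)) (hY _)
    ((hα ⟨S, hS𝓢⟩ W R w).2 (hS ⟨S, hS𝓢⟩) x)

/-! ### Descriptive frames and Esakia's lemma -/

/-- If the diamond of a relation preserves closed sets and open sets, then the truth set of a
formula is closed whenever the variables with positive occurrences have closed values and those
with negative occurrences have open values, and dually. -/
theorem isClosed_and_isOpen_setOf_holds {X : Type*} [TopologicalSpace X] {R : X → X → Prop}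
    (hC : ∀ C, IsClosed C → IsClosed {x | ∃ y, R x y ∧ y ∈ C})
    (hO : ∀ O, IsOpen O → IsOpen {x | ∃ y, R x y ∧ y ∈ O}) (φ : MLFormula) (V : ℕ → Set X) :
    ((∀ q ∈ φ.occ true, IsClosed (V q)) → (∀ q ∈ φ.occ false, IsOpen (V q)) →
      IsClosed {x | φ.Holds R V x}) ∧
    ((∀ q ∈ φ.occ true, IsOpen (V q)) → (∀ q ∈ φ.occ false, IsClosed (V q)) →
      IsOpen {x | φ.Holds R V x}) := by
  induction φ with
  | var p => exact ⟨fun h _ => h p ⟨rfl, rfl⟩, fun h _ => h p ⟨rfl, rfl⟩⟩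
  | bot => exact ⟨fun _ _ => isClosed_empty, fun _ _ => isOpen_empty⟩
  | top => exact ⟨fun _ _ => isClosed_univ, fun _ _ => isOpen_univ⟩
  | neg φ ih =>
    exact ⟨fun h h' => (ih.2 h' h).isClosed_compl, fun h h' => (ih.1 h' h).isOpen_compl⟩
  | or φ ψ ih₁ ih₂ =>
    exact ⟨fun h h' => (ih₁.1 (fun q hq => h q (.inl hq)) (fun q hq => h' q (.inl hq))).union
        (ih₂.1 (fun q hq => h q (.inr hq)) (fun q hq => h' q (.inr hq))),
      fun h h' => (ih₁.2 (fun q hq => h q (.inl hq)) (fun q hq => h' q (.inl hq))).union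
        (ih₂.2 (fun q hq => h q (.inr hq)) (fun q hq => h' q (.inr hq)))⟩
  | and φ ψ ih₁ ih₂ =>
    exact ⟨fun h h' => (ih₁.1 (fun q hq => h q (.inl hq)) (fun q hq => h' q (.inl hq))).inter
        (ih₂.1 (fun q hq => h q (.inr hq)) (fun q hq => h' q (.inr hq))),
      fun h h' => (ih₁.2 (fun q hq => h q (.inl hq)) (fun q hq => h' q (.inl hq))).inter
        (ih₂.2 (fun q hq => h q (.inr hq)) (fun q hq => h' q (.inr hq)))⟩
  | dia φ ih => exact ⟨fun h h' => hC _ (ih.1 h h'), fun h h' => hO _ (ih.2 h h')⟩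
  | box φ ih =>
    have hbox : {x | φ.box.Holds R V x} = {x | ∃ y, R x y ∧ y ∈ {y | φ.Holds R V y}ᶜ}ᶜ := by
      ext x
      simp [MLFormula.Holds]
    rw [hbox]
    exact ⟨fun h h' => (hO _ (ih.1 h h').isOpen_compl).isClosed_compl,
      fun h h' => (hC _ (ih.2 h h').isClosed_compl).isOpen_compl⟩

/-- Descriptive frames, up to the compactness and the `T₁` axiom of the space of worlds, which are
assumed as instances where they are needed: the admissible sets are the clopen sets. -/
structure IsDescriptive {W : Type*} [TopologicalSpace W] (R : W → W → Prop) : Prop where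
  isClosed_rel : IsClosed {a : W × W | R a.1 a.2}
  isOpen_dia : ∀ O, IsOpen O → IsOpen {x | ∃ y, R x y ∧ y ∈ O}
  isTopologicalBasis : TopologicalSpace.IsTopologicalBasis {U : Set W | IsClopen U}

/-- The closed valuations that agree with `V` on the set `G` of variables. -/
def ClosedValuation {W : Type*} [TopologicalSpace W] (V : ℕ → Set W) (G : Set ℕ) : Type _ :=
  {V' : ℕ → Set W // (∀ q, IsClosed (V' q)) ∧ ∀ q ∈ G, V' q = V q}

/-- The upper topology: an open set has to contain, with each closed valuation, all those below
some clopen valuation above it. -/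
instance {W : Type*} [TopologicalSpace W] (V : ℕ → Set W) (G : Set ℕ) :
    TopologicalSpace (ClosedValuation V G) where
  IsOpen 𝒪 := ∀ V₁ ∈ 𝒪, ∃ U : ℕ → Set W, (∀ q, IsClopen (U q)) ∧ (∀ q, V₁.1 q ⊆ U q) ∧
    ∀ V₂ : ClosedValuation V G, (∀ q, V₂.1 q ⊆ U q) → V₂ ∈ 𝒪
  isOpen_univ _ _ := ⟨fun _ => Set.univ, fun _ => isClopen_univ, fun _ => Set.subset_univ _,
    fun _ _ => trivial⟩
  isOpen_inter 𝒪₁ 𝒪₂ h₁ h₂ V₁ hV₁ := by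
    obtain ⟨U₁, hc₁, hs₁, hU₁⟩ := h₁ V₁ hV₁.1
    obtain ⟨U₂, hc₂, hs₂, hU₂⟩ := h₂ V₁ hV₁.2
    exact ⟨fun q => U₁ q ∩ U₂ q, fun q => (hc₁ q).inter (hc₂ q),
      fun q => Set.subset_inter (hs₁ q) (hs₂ q),
      fun V₂ h => ⟨hU₁ V₂ fun q => (h q).trans Set.inter_subset_left,
        hU₂ V₂ fun q => (h q).trans Set.inter_subset_right⟩⟩
  isOpen_sUnion 𝒞 h V₁ := by
    rintro ⟨𝒪, h𝒪, hV₁⟩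
    obtain ⟨U, hc, hs, hU⟩ := h 𝒪 h𝒪 V₁ hV₁
    exact ⟨U, hc, hs, fun V₂ h => ⟨𝒪, h𝒪, hU V₂ h⟩⟩

theorem MLFormula.holds_prod_iff {W D : Type*} {R : W → W → Prop} (V : D → ℕ → Set W)
    (φ : MLFormula) (a : W × D) :
    φ.Holds (fun a b : W × D => R a.1 b.1 ∧ a.2 = b.2) (fun q => {a | a.1 ∈ V a.2 q}) a ↔
      φ.Holds R (V a.2) a.1 := by
  induction φ generalizing a with
  | var p => exact Iff.rfl
  | bot => exact Iff.rfl
  | top => exact Iff.rfl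
  | neg φ ih => exact not_congr (ih a)
  | or φ ψ ih₁ ih₂ => exact or_congr (ih₁ a) (ih₂ a)
  | and φ ψ ih₁ ih₂ => exact and_congr (ih₁ a) (ih₂ a)
  | dia φ ih =>
    constructor
    · rintro ⟨⟨y, d⟩, ⟨hy, rfl⟩, h⟩
      exact ⟨y, hy, (ih _).1 h⟩
    · rintro ⟨y, hy, h⟩
      exact ⟨(y, a.2), ⟨hy, rfl⟩, (ih _).2 h⟩
  | box φ ih =>
    constructor
    · exact fun h y hy => (ih (y, a.2)).1 (h (y, a.2) ⟨hy, rfl⟩)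
    · rintro h ⟨y, d⟩ ⟨hy, rfl⟩
      exact (ih _).2 (h y hy)

namespace IsDescriptive

variable {W : Type*} [TopologicalSpace W] [CompactSpace W] {R : W → W → Prop}

omit [CompactSpace W] in
theorem exists_isClopen_superset (hR : IsDescriptive R) {C : Set W} (hC : IsClosed C) {x : W}
    (hx : x ∉ C) : ∃ U, IsClopen U ∧ C ⊆ U ∧ x ∉ U := by
  obtain ⟨N, hN, hxN, hNC⟩ := hR.isTopologicalBasis.exists_subset_of_mem_open hx hC.isOpen_compl
  exact ⟨Nᶜ, hN.compl, fun y hy hyN => hNC hyN hy, fun h => h hxN⟩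

theorem isClosed_dia_prod (hR : IsDescriptive R) {D : Type*} [TopologicalSpace D] {C : Set (W × D)}
    (hC : IsClosed C) : IsClosed {a : W × D | ∃ b, (R a.1 b.1 ∧ a.2 = b.2) ∧ b ∈ C} := by
  -- The set is the projection along the compact space of successors.
  have h : IsClosed {c : W × (W × D) | R c.2.1 c.1 ∧ (c.1, c.2.2) ∈ C} :=
    (hR.isClosed_rel.preimage (f := fun c : W × (W × D) => (c.2.1, c.1)) (by fun_prop)).inter
      (hC.preimage (f := fun c : W × (W × D) => (c.1, c.2.2)) (by fun_prop))
  convert isClosedMap_snd_of_compactSpace _ h using 1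
  ext ⟨x, d⟩
  simp only [Set.mem_ofPred_eq, Set.mem_image, Prod.exists]
  constructor
  · rintro ⟨y, _, ⟨hy, rfl⟩, h⟩
    exact ⟨y, x, d, ⟨hy, h⟩, rfl⟩
  · rintro ⟨y, _, _, ⟨hy, h⟩, heq⟩
    obtain ⟨rfl, rfl⟩ := Prod.mk.inj heq
    exact ⟨y, _, ⟨hy, rfl⟩, h⟩

omit [CompactSpace W] in
theorem isOpen_dia_prod (hR : IsDescriptive R) {D : Type*} [TopologicalSpace D] {O : Set (W × D)}
    (hO : IsOpen O) : IsOpen {a : W × D | ∃ b, (R a.1 b.1 ∧ a.2 = b.2) ∧ b ∈ O} := by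
  rw [isOpen_prod_iff]
  rintro x d ⟨⟨y, _⟩, ⟨hy, rfl⟩, h⟩
  obtain ⟨N, M, hN, hM, hyN, hdM, hNM⟩ := isOpen_prod_iff.1 hO y _ h
  refine ⟨_, M, hR.isOpen_dia N hN, hM, ⟨y, hy, hyN⟩, hdM, ?_⟩
  rintro ⟨x', d'⟩ ⟨⟨y', hy', hyN'⟩, hd'⟩
  exact ⟨(y', d'), ⟨hy', rfl⟩, hNM ⟨hyN', hd'⟩⟩

theorem isClosed_dia (hR : IsDescriptive R) {C : Set W} (hC : IsClosed C) :
    IsClosed {x | ∃ y, R x y ∧ y ∈ C} := by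
  have h : IsClosed {c : W × W | R c.2 c.1 ∧ c.1 ∈ C} :=
    (hR.isClosed_rel.preimage continuous_swap).inter (hC.preimage continuous_fst)
  convert isClosedMap_snd_of_compactSpace _ h using 1
  ext x
  simp

theorem isClosed_image (hR : IsDescriptive R) {C : Set W} (hC : IsClosed C) :
    IsClosed {y | ∃ x ∈ C, R x y} := by
  have h : IsClosed {c : W × W | c.1 ∈ C ∧ R c.1 c.2} :=
    (hC.preimage continuous_fst).inter hR.isClosed_rel
  convert isClosedMap_snd_of_compactSpace _ h using 1
  ext x
  simp

/-- Esakia's lemma, for all variables simultaneously: if a formula is false at a world under a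
closed valuation, it remains false there when the values of the variables are enlarged to certain
clopen sets, except for the variables with negative occurrences, whose values are supposed to be
clopen already. It expresses that the truth set of the formula is closed in the product of the
frame with a space of valuations. -/
theorem exists_clopen_valuation_not_holds (hR : IsDescriptive R) {V : ℕ → Set W}
    (hV : ∀ q, IsClosed (V q)) {ψ : MLFormula} (hneg : ∀ q ∈ ψ.occ false, IsClopen (V q))
    {x : W} (hx : ¬ ψ.Holds R V x) :
    ∃ U : ℕ → Set W, (∀ q, IsClopen (U q)) ∧ (∀ q, V q ⊆ U q) ∧
      ∀ V' : ℕ → Set W, (∀ q ∈ ψ.occ false, V' q = V q) → (∀ q ∈ ψ.occ true, V' q ⊆ U q) →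
        ¬ ψ.Holds R V' x := by
  classical
  let D := ClosedValuation V (ψ.occ false)
  have hmem : ∀ q, IsClosed {a : W × D | a.1 ∈ a.2.1 q} := fun q => by
    rw [← isOpen_compl_iff, isOpen_prod_iff]
    intro y V₁ hy
    obtain ⟨N, hN, hVN, hyN⟩ := hR.exists_isClopen_superset (V₁.2.1 q) hy
    refine ⟨Nᶜ, {V₂ | V₂.1 q ⊆ N}, hN.compl.isOpen, fun V₂ hV₂ => ?_, hyN, hVN,
      fun a ha h => ha.1 (ha.2 h)⟩
    refine ⟨Function.update (fun _ => Set.univ) q N, fun s => ?_, fun s => ?_, fun V₃ h => ?_⟩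
    · rcases eq_or_ne s q with rfl | hs
      · simpa using hN
      · simpa [hs] using isClopen_univ
    · rcases eq_or_ne s q with rfl | hs
      · rw [Function.update_self]
        exact hV₂
      · simp [hs]
    · have := h q
      rwa [Function.update_self] at this
  have hclosed := (isClosed_and_isOpen_setOf_holds
    (fun C => hR.isClosed_dia_prod (D := D) (C := C))
    (fun O => hR.isOpen_dia_prod (D := D) (O := O)) ψ (fun q => {a | a.1 ∈ a.2.1 q})).1
    (fun q _ => hmem q) (fun q hq => by
      convert (hneg q hq).isOpen.preimage (continuous_fst (Y := D)) using 1
      ext ⟨y, V₁⟩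
      simp [V₁.2.2 q hq])
  obtain ⟨M, 𝒪, -, h𝒪, hxM, hV𝒪, hM𝒪⟩ := isOpen_prod_iff.1 hclosed.isOpen_compl x
    (⟨V, hV, fun _ _ => rfl⟩ : D) (fun h => hx ((ψ.holds_prod_iff (fun d : D => d.1) _).1 h))
  obtain ⟨U, hUc, hVU, hU⟩ := h𝒪 _ hV𝒪
  refine ⟨U, hUc, hVU, fun V' hneg' hpos' h => ?_⟩
  have hmem𝒪 : (⟨fun q => if q ∈ ψ.occ false then V q else U q, fun q => by
      dsimp only
      split_ifs <;> [exact hV q; exact (hUc q).isClosed], fun q hq => if_pos hq⟩ : D) ∈ 𝒪 := by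
    refine hU _ fun q => ?_
    dsimp only
    split_ifs <;> [exact hVU q; exact subset_rfl]
  refine hM𝒪 (Set.mk_mem_prod hxM hmem𝒪)
    ((ψ.holds_prod_iff (fun d : D => d.1) _).2 (h.mono (fun q hq => ?_) (fun q hq => ?_)))
  · dsimp only
    split_ifs with hq' <;> [exact (hneg' q hq').subset; exact hpos' q hq]
  · dsimp only
    rw [if_pos hq, hneg' q hq]

theorem isClosed_reach (hR : IsDescriptive R) {V : ℕ → Set W} (hV : ∀ q, IsClosed (V q))
    (B : BoxForm) {S : Set W} (hS : IsClosed S) : IsClosed (B.reach R V S) := by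
  induction B generalizing S with
  | sharp => exact hS
  | box B ih => exact ih (hR.isClosed_image hS)
  | imp A hA B ih =>
    refine ih (hS.inter ((isClosed_and_isOpen_setOf_holds (fun _ => hR.isClosed_dia)
      hR.isOpen_dia A V).1 (fun q _ => hV q) fun q hq => ?_))
    rw [hA] at hq
    exact hq.elim

theorem isClosed_leastValuation [T1Space W] (hR : IsDescriptive R) {ι : Type*} [Finite ι]
    (b : ι → BoxForm × ℕ) (x : ι → W) (n p : ℕ) : IsClosed (leastValuation R b x n p) := by
  induction n generalizing p with
  | zero => exact isClosed_empty
  | succ n ih =>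
    have h : leastValuation R b x (n + 1) p = ⋃ i, {y | (b i).2 = p ∧
        y ∈ (b i).1.reach R (leastValuation R b x n) {x i}} := by
      ext y
      simp [leastValuation, valuationStep]
    rw [h]
    refine isClosed_iUnion_of_finite fun i => ?_
    by_cases hi : (b i).2 = p
    · simpa [hi] using hR.isClosed_reach ih (b i).1 isClosed_singleton
    · simp [hi]

variable {ι : Type*} [Finite ι] {b : ι → BoxForm × ℕ} {x : ι → W}

/-- If a closed valuation `V` makes the box-formulae `b i` true at the worlds `x i`, then for any
clopen valuation `O` above `V` there is a smaller clopen valuation `U` above `V` such that the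
box-formulae are true when their heads are interpreted by `O` and the other variables by `U`. -/
theorem exists_clopen_valuation_holds_update (hR : IsDescriptive R) {V : ℕ → Set W}
    (hV : ∀ q, IsClosed (V q)) (hb : ∀ i, (b i).2 ∉ (b i).1.inessential)
    (hVx : ∀ i, ((b i).1.app (b i).2).Holds R V (x i)) {O : ℕ → Set W}
    (hO : ∀ q, IsClopen (O q)) (hVO : ∀ q, V q ⊆ O q) :
    ∃ U : ℕ → Set W, (∀ q, IsClopen (U q)) ∧ (∀ q, V q ⊆ U q) ∧ (∀ q, U q ⊆ O q) ∧
      ∀ i, ((b i).1.app (b i).2).Holds R (Function.update U (b i).2 (O (b i).2)) (x i) := by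
  have hocc : ∀ i, ((b i).1.app (b i).2).neg.occ false = {(b i).2} := fun i =>
    (b i).1.occ_true_app (b i).2
  have hocc' : ∀ i, ∀ q ∈ ((b i).1.app (b i).2).occ false, q ≠ (b i).2 := by
    rintro i q hq rfl
    exact hb i ((b i).1.occ_false_app_subset _ hq)
  have hUi : ∀ i, ∃ U : ℕ → Set W, (∀ q, IsClopen (U q)) ∧ (∀ q, V q ⊆ U q) ∧
      ∀ U' : ℕ → Set W, (∀ q, U' q ⊆ U q) →
        ((b i).1.app (b i).2).Holds R (Function.update U' (b i).2 (O (b i).2)) (x i) := fun i => by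
    obtain ⟨U, hU, hVU, h⟩ := hR.exists_clopen_valuation_not_holds
      (V := Function.update V (b i).2 (O (b i).2)) (ψ := ((b i).1.app (b i).2).neg) (x := x i)
      (fun q => by
        rcases eq_or_ne q (b i).2 with rfl | hq
        · simpa using (hO _).isClosed
        · simpa [hq] using hV q)
      (fun q hq => by
        rw [hocc i] at hq
        obtain rfl := hq
        simpa using hO _)
      (not_not.2 ((hVx i).mono
        (fun q hq => by
          rw [(b i).1.occ_true_app] at hq
          obtain rfl := hq
          simpa using hVO _)
        (fun q hq => by simp [hocc' i q hq])))
    refine ⟨U, hU, fun q => ?_, fun U' hU' => not_not.1 (h _ ?_ ?_)⟩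
    · refine subset_trans ?_ (hVU q)
      rcases eq_or_ne q (b i).2 with rfl | hq
      · simpa using hVO _
      · simp [hq]
    · intro q hq
      rw [hocc i] at hq
      obtain rfl := hq
      simp
    · intro q hq
      simpa [hocc' i q hq] using hU' q
  choose U hU hVU h using hUi
  refine ⟨fun q => O q ∩ ⋂ i, U i q, fun q => (hO q).inter (isClopen_iInter_of_finite (hU · q)),
    fun q => Set.subset_inter (hVO q) (Set.subset_iInter (hVU · q)),
    fun q => Set.inter_subset_left,
    fun i => h i _ fun q => Set.inter_subset_right.trans (Set.iInter_subset _ i)⟩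

/-- If a closed valuation `V` makes box-formulae true at certain worlds and the variables are
ranked so that the heads are above the inessential variables, then there is a clopen valuation
below any given clopen valuation `O` above `V` that also makes them true. -/
theorem exists_clopen_valuation_holds (hR : IsDescriptive R) {r : ℕ → ℕ} {N : ℕ}
    (hN : ∀ p, r p < N) (hr : ∀ i, ∀ q ∈ (b i).1.inessential, r q < r (b i).2)
    {V : ℕ → Set W} (hV : ∀ q, IsClosed (V q))
    (hVx : ∀ i, ((b i).1.app (b i).2).Holds R V (x i)) {O : ℕ → Set W}
    (hO : ∀ q, IsClopen (O q)) (hVO : ∀ q, V q ⊆ O q) :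
    ∃ U : ℕ → Set W, (∀ q, IsClopen (U q)) ∧ (∀ q, U q ⊆ O q) ∧
      ∀ i, ((b i).1.app (b i).2).Holds R U (x i) := by
  have hstep : ∀ O : {O : ℕ → Set W // (∀ q, IsClopen (O q)) ∧ ∀ q, V q ⊆ O q},
      ∃ U : {O : ℕ → Set W // (∀ q, IsClopen (O q)) ∧ ∀ q, V q ⊆ O q}, (∀ q, U.1 q ⊆ O.1 q) ∧
        ∀ i, ((b i).1.app (b i).2).Holds R (Function.update U.1 (b i).2 (O.1 (b i).2)) (x i) :=
    fun O => by
      obtain ⟨U, h₁, h₂, h₃, h₄⟩ := hR.exists_clopen_valuation_holds_update hV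
        (fun i hi => (hr i _ hi).false) hVx O.2.1 O.2.2
      exact ⟨⟨U, h₁, h₂⟩, h₃, h₄⟩
  choose f hf hfx using hstep
  let Z : ℕ → {O : ℕ → Set W // (∀ q, IsClopen (O q)) ∧ ∀ q, V q ⊆ O q} :=
    fun n => f^[n] ⟨O, hO, hVO⟩
  have hZ : ∀ n, Z (n + 1) = f (Z n) := fun n => Function.iterate_succ_apply' f n _
  have hanti : ∀ q, Antitone fun n => (Z n).1 q := fun q => antitone_nat_of_succ_le fun n => by
    rw [hZ]
    exact hf _ q
  -- Variables of lower rank are interpreted further down in the sequence.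
  refine ⟨fun q => (Z (N - r q)).1 q, fun q => (Z _).2.1 q, fun q => hanti q (Nat.zero_le _),
    fun i => ?_⟩
  refine (hfx (Z (N - r (b i).2)) i).mono (fun q hq => ?_) (fun q hq => ?_)
  · rw [(b i).1.occ_true_app] at hq
    obtain rfl := hq
    simp
  · have hlt := hr i q ((b i).1.occ_false_app_subset _ hq)
    have hne : q ≠ (b i).2 := by
      rintro rfl
      exact hlt.false
    rw [Function.update_of_ne hne, ← hZ]
    exact hanti q (by have := hN (b i).2; omega)

end IsDescriptive

/-- A monadic inductive formula that can be refuted in a descriptive frame can be refuted under an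
admissible valuation at the same world. -/
theorem IsMonadicInductive.exists_clopen_valuation {φ : MLFormula} (hφ : IsMonadicInductive φ)
    {W : Type u} [TopologicalSpace W] [CompactSpace W] [T1Space W] {R : W → W → Prop}
    (hR : IsDescriptive R) {V : ℕ → Set W} {w : W} (hw : ¬ φ.Holds R V w) :
    ∃ U : ℕ → Set W, (∀ q, IsClopen (U q)) ∧ ¬ φ.Holds R U w := by
  obtain ⟨𝓢, -, hrank, h⟩ := hφ.exists_shapes.{u}
  obtain ⟨S, hS, x, Y, hYpos, hY, hV'⟩ := h W R V w hw
  obtain ⟨r, N, hN, hr⟩ := hrank S hS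
  have hcl := hR.isClosed_leastValuation S.get x N
  have hO : ∃ O : ℕ → Set W, (∀ q, IsClopen (O q)) ∧
      (∀ q, leastValuation R S.get x N q ⊆ O q) ∧
      ∀ U : ℕ → Set W, (∀ q, U q ⊆ O q) → ∀ y ∈ Y, ¬ y.2.Holds R U y.1 := by
    have hy : ∀ y : {y // y ∈ Y}, ∃ U : ℕ → Set W, (∀ q, IsClopen (U q)) ∧
        (∀ q, leastValuation R S.get x N q ⊆ U q) ∧
        ∀ V' : ℕ → Set W, (∀ q, V' q ⊆ U q) → ¬ y.1.2.Holds R V' y.1.1 := fun y => by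
      have hocc : ∀ q, q ∉ y.1.2.occ false := fun q hq => by
        rw [hYpos y.1 y.2] at hq
        exact hq
      obtain ⟨U, hU, hVU, h⟩ := hR.exists_clopen_valuation_not_holds hcl
        (fun q hq => (hocc q hq).elim) (hY N y.1 y.2)
      exact ⟨U, hU, hVU, fun V' hV' => h V' (fun q hq => (hocc q hq).elim) fun q _ => hV' q⟩
    choose U hU hVU h using hy
    have : Finite {y // y ∈ Y} := (List.finite_toSet Y).to_subtype
    exact ⟨fun q => ⋂ y, U y q, fun q => isClopen_iInter_of_finite (hU · q),
      fun q => Set.subset_iInter (hVU · q),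
      fun U' hU' y hy => h ⟨y, hy⟩ U' fun q => (hU' q).trans (Set.iInter_subset _ _)⟩
  obtain ⟨O, hO, hVO, hOY⟩ := hO
  obtain ⟨U, hU, hUO, hUx⟩ := hR.exists_clopen_valuation_holds hN hr hcl
    (holds_leastValuation hr hN) hO hVO
  exact ⟨U, hU, hV' U hUx (hOY U hUO)⟩

/-! ### Maximal consistent sets -/

namespace MLFormula

theorem propValue_conj (v : MLFormula → Prop) (l : List MLFormula) :
    (conj l).propValue v ↔ ∀ φ ∈ l, φ.propValue v := by
  induction l with
  | nil => simp [conj, propValue]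
  | cons φ l ih => simp [conj, propValue, ih]

theorem propValue_imp (v : MLFormula → Prop) (φ ψ : MLFormula) :
    (φ.imp ψ).propValue v ↔ (φ.propValue v → ψ.propValue v) := by
  simp [imp, propValue, imp_iff_not_or]

theorem propValue_neg (v : MLFormula → Prop) (φ : MLFormula) :
    φ.neg.propValue v ↔ ¬ φ.propValue v := Iff.rfl

end MLFormula

open MLFormula in
/-- A normal logic is closed under tautological consequences of finitely many premises. -/
theorem IsNormalLogic.mem_of_consequence {Λ : Set MLFormula} (hΛ : IsNormalLogic Λ)
    (l : List MLFormula) {ψ : MLFormula} (hl : ∀ φ ∈ l, φ ∈ Λ)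
    (h : ∀ v, (∀ φ ∈ l, φ.propValue v) → ψ.propValue v) : ψ ∈ Λ := by
  induction l generalizing ψ with
  | nil => exact hΛ.taut _ fun v => h v (by simp)
  | cons φ l ih =>
    refine hΛ.mp φ ψ (ih (fun χ hχ => hl χ (List.mem_cons_of_mem _ hχ)) fun v hv => ?_)
      (hl φ List.mem_cons_self)
    exact (propValue_imp v φ ψ).2 fun hφ => h v (List.forall_mem_cons.2 ⟨hφ, hv⟩)

section Consistency

open MLFormula

variable {Λ Γ : Set MLFormula}

/-- If `Γ ∪ {ψ}` is inconsistent, then `¬ψ` follows from finitely many members of `Γ`. -/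
theorem exists_imp_neg_mem_of_not_consistent (hΛ : IsNormalLogic Λ) {ψ : MLFormula}
    (h : ¬ LogicConsistent Λ (insert ψ Γ)) :
    ∃ l : List MLFormula, (∀ φ ∈ l, φ ∈ Γ) ∧ (conj l).imp ψ.neg ∈ Λ := by
  classical
  simp only [LogicConsistent, not_forall, not_not] at h
  obtain ⟨l, hl, hmem⟩ := h
  refine ⟨l.filter (· ≠ ψ), fun φ hφ => ?_, hΛ.mem_of_consequence [(conj l).neg] (by simpa)
    fun v hv => ?_⟩
  · simp only [ne_eq, decide_not, List.mem_filter, Bool.not_eq_eq_eq_not, Bool.not_true,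
      decide_eq_false_iff_not] at hφ
    exact (hl φ hφ.1).resolve_left hφ.2
  · simp only [List.mem_cons, List.not_mem_nil, or_false, forall_eq, propValue_neg, propValue_imp,
      propValue_conj] at hv ⊢
    refine fun h hψ => hv fun φ hφ => ?_
    by_cases he : φ = ψ
    · exact he ▸ hψ
    · exact h φ (by simp [hφ, he])

theorem exists_canonicalWorld_superset (hΓ : LogicConsistent Λ Γ) :
    ∃ Δ : CanonicalWorld Λ, Γ ⊆ Δ.1 := by
  obtain ⟨Δ, hΓΔ, hΔ⟩ := zorn_subset_nonempty {Δ | LogicConsistent Λ Δ} (fun c hc hchain hne =>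
    ⟨⋃₀ c, fun l hl => by
      have : ∃ Δ ∈ c, ∀ φ ∈ l, φ ∈ Δ := by
        have hfin : {φ | φ ∈ l}.Finite := List.finite_toSet l
        exact DirectedOn.exists_mem_subset_of_finite_of_subset_sUnion hne hchain.directedOn hfin hl
      obtain ⟨Δ, hΔ, hlΔ⟩ := this
      exact hc hΔ l hlΔ, fun _ => Set.subset_sUnion_of_mem⟩) Γ hΓ
  exact ⟨⟨Δ, hΔ.prop, fun Δ' h h' => (hΔ.le_of_ge h h').antisymm h'⟩, hΓΔ⟩

namespace CanonicalWorld

theorem mem_of_imp_mem (hΛ : IsNormalLogic Λ) (Γ : CanonicalWorld Λ) {l : List MLFormula}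
    (hl : ∀ φ ∈ l, φ ∈ Γ.1) {ψ : MLFormula} (h : (conj l).imp ψ ∈ Λ) : ψ ∈ Γ.1 := by
  by_contra hψ
  have hnot : ¬ LogicConsistent Λ (insert ψ Γ.1) := fun hc =>
    hψ (Γ.2.2 _ hc (Set.subset_insert _ _) ▸ Set.mem_insert _ _)
  obtain ⟨l', hl', h'⟩ := exists_imp_neg_mem_of_not_consistent hΛ hnot
  refine Γ.2.1 (l ++ l') (fun φ hφ => (List.mem_append.1 hφ).elim (hl φ) (hl' φ))
    (hΛ.mem_of_consequence [(conj l).imp ψ, (conj l').imp ψ.neg] (by simp [h, h'])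
      fun v hv => ?_)
  simp only [List.mem_cons, List.not_mem_nil, or_false, forall_eq_or_imp, forall_eq,
    propValue_imp, propValue_neg, propValue_conj, List.mem_append] at hv ⊢
  exact fun hall => hv.2 (fun φ hφ => hall φ (.inr hφ)) (hv.1 fun φ hφ => hall φ (.inl hφ))

theorem mem_of_mem_logic (hΛ : IsNormalLogic Λ) (Γ : CanonicalWorld Λ) {ψ : MLFormula}
    (h : ψ ∈ Λ) : ψ ∈ Γ.1 :=
  Γ.mem_of_imp_mem hΛ (l := []) (by simp) (hΛ.mem_of_consequence [ψ] (by simpa) fun v hv => by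
    simp only [List.mem_cons, List.not_mem_nil, or_false, forall_eq, propValue_imp] at hv ⊢
    exact fun _ => hv)

theorem mem_of_consequence (hΛ : IsNormalLogic Λ) (Γ : CanonicalWorld Λ) (l : List MLFormula)
    {ψ : MLFormula} (hl : ∀ φ ∈ l, φ ∈ Γ.1)
    (h : ∀ v, (∀ φ ∈ l, φ.propValue v) → ψ.propValue v) : ψ ∈ Γ.1 :=
  Γ.mem_of_imp_mem hΛ hl (hΛ.taut _ fun v =>
    (propValue_imp v _ _).2 fun h' => h v ((propValue_conj v l).1 h'))

theorem bot_notMem (hΛ : IsNormalLogic Λ) (Γ : CanonicalWorld Λ) : bot ∉ Γ.1 := fun h =>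
  Γ.2.1 [bot] (by simpa) (hΛ.taut _ fun v => by simp [propValue, conj])

theorem neg_mem_iff (hΛ : IsNormalLogic Λ) (Γ : CanonicalWorld Λ) {ψ : MLFormula} :
    ψ.neg ∈ Γ.1 ↔ ψ ∉ Γ.1 := by
  refine ⟨fun h h' => Γ.bot_notMem hΛ (Γ.mem_of_consequence hΛ [ψ, ψ.neg] (by simp [h, h'])
    fun v hv => ?_), fun h => ?_⟩
  · simp [propValue] at hv
  · have hnot : ¬ LogicConsistent Λ (insert ψ Γ.1) := fun hc =>
      h (Γ.2.2 _ hc (Set.subset_insert _ _) ▸ Set.mem_insert _ _)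
    obtain ⟨l, hl, h'⟩ := exists_imp_neg_mem_of_not_consistent hΛ hnot
    exact Γ.mem_of_imp_mem hΛ hl h'

theorem and_mem_iff (hΛ : IsNormalLogic Λ) (Γ : CanonicalWorld Λ) {φ ψ : MLFormula} :
    φ.and ψ ∈ Γ.1 ↔ φ ∈ Γ.1 ∧ ψ ∈ Γ.1 := by
  refine ⟨fun h => ⟨?_, ?_⟩, fun h => Γ.mem_of_consequence hΛ [φ, ψ] (by simp [h])
    fun v hv => by simpa [propValue] using hv⟩
  · exact Γ.mem_of_consequence hΛ [φ.and ψ] (by simp [h])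
      fun v hv => (List.forall_mem_singleton.1 hv).1
  · exact Γ.mem_of_consequence hΛ [φ.and ψ] (by simp [h])
      fun v hv => (List.forall_mem_singleton.1 hv).2

theorem or_mem_iff (hΛ : IsNormalLogic Λ) (Γ : CanonicalWorld Λ) {φ ψ : MLFormula} :
    φ.or ψ ∈ Γ.1 ↔ φ ∈ Γ.1 ∨ ψ ∈ Γ.1 := by
  refine ⟨fun h => or_iff_not_imp_left.2 fun hφ => ?_, ?_⟩
  · refine Γ.mem_of_consequence hΛ [φ.or ψ, φ.neg] (by simp [h, (Γ.neg_mem_iff hΛ).2 hφ])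
      fun v hv => ?_
    simp only [List.mem_cons, List.not_mem_nil, or_false, forall_eq_or_imp, forall_eq] at hv
    exact hv.1.resolve_left hv.2
  · rintro (h | h)
    · exact Γ.mem_of_consequence hΛ [φ] (by simp [h])
        fun v hv => .inl (List.forall_mem_singleton.1 hv)
    · exact Γ.mem_of_consequence hΛ [ψ] (by simp [h])
        fun v hv => .inr (List.forall_mem_singleton.1 hv)

theorem mem_of_imp (hΛ : IsNormalLogic Λ) (Γ : CanonicalWorld Λ) {φ ψ : MLFormula}
    (h : φ.imp ψ ∈ Λ) (hφ : φ ∈ Γ.1) : ψ ∈ Γ.1 :=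
  ((Γ.or_mem_iff hΛ).1 (Γ.mem_of_mem_logic hΛ h)).resolve_left fun hn =>
    (Γ.neg_mem_iff hΛ).1 hn hφ

theorem box_mem_of_imp (hΛ : IsNormalLogic Λ) (Γ : CanonicalWorld Λ) {φ ψ : MLFormula}
    (h : φ.imp ψ ∈ Λ) (hφ : φ.box ∈ Γ.1) : ψ.box ∈ Γ.1 :=
  Γ.mem_of_imp hΛ (hΛ.mp _ _ (hΛ.distr φ ψ) (hΛ.nec _ h)) hφ

theorem box_conj_mem (hΛ : IsNormalLogic Λ) (Γ : CanonicalWorld Λ) {l : List MLFormula}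
    (hl : ∀ φ ∈ l, φ.box ∈ Γ.1) : (conj l).box ∈ Γ.1 := by
  induction l with
  | nil => exact Γ.mem_of_mem_logic hΛ (hΛ.nec _ (hΛ.taut top fun _ => trivial))
  | cons φ l ih =>
    have h₁ : ((conj l).imp (conj (φ :: l))).box ∈ Γ.1 :=
      Γ.box_mem_of_imp hΛ (hΛ.taut _ fun v => by
        simp only [propValue_imp, propValue_conj, List.forall_mem_cons]
        exact fun a b => ⟨a, b⟩) (hl φ List.mem_cons_self)
    refine ((Γ.or_mem_iff hΛ).1 (Γ.mem_of_imp hΛ (hΛ.distr _ _) h₁)).resolve_left fun hn =>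
      (Γ.neg_mem_iff hΛ).1 hn (ih fun χ hχ => hl χ (List.mem_cons_of_mem _ hχ))

theorem box_mem_iff (hΛ : IsNormalLogic Λ) (Γ : CanonicalWorld Λ) {ψ : MLFormula} :
    ψ.box ∈ Γ.1 ↔ ∀ Δ, canonicalRel Λ Γ Δ → ψ ∈ Δ.1 := by
  refine ⟨fun h Δ hΔ => hΔ ψ h, fun h => ?_⟩
  by_contra hψ
  have hc : LogicConsistent Λ (insert ψ.neg {χ | χ.box ∈ Γ.1}) := by
    by_contra hn
    obtain ⟨l, hl, h'⟩ := exists_imp_neg_mem_of_not_consistent hΛ hn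
    refine hψ (Γ.box_mem_of_imp hΛ ?_ (Γ.box_conj_mem hΛ hl))
    refine hΛ.mem_of_consequence [(conj l).imp ψ.neg.neg] (by simpa) fun v hv => ?_
    simpa [propValue_imp, propValue_neg] using hv
  obtain ⟨Δ, hΔ⟩ := exists_canonicalWorld_superset hc
  exact (Δ.neg_mem_iff hΛ).1 (hΔ (Set.mem_insert _ _))
    (h Δ fun χ hχ => hΔ (Set.mem_insert_of_mem _ hχ))

theorem dia_mem_iff (hΛ : IsNormalLogic Λ) (Γ : CanonicalWorld Λ) {ψ : MLFormula} :
    ψ.dia ∈ Γ.1 ↔ ∃ Δ, canonicalRel Λ Γ Δ ∧ ψ ∈ Δ.1 := by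
  have hdual : ψ.dia ∈ Γ.1 ↔ ψ.neg.box.neg ∈ Γ.1 := by
    refine ⟨Γ.mem_of_imp hΛ ?_, Γ.mem_of_imp hΛ ?_⟩
    · exact hΛ.mem_of_consequence [_] (List.forall_mem_singleton.2 (hΛ.dual ψ))
        fun v hv => (List.forall_mem_singleton.1 hv).1
    · exact hΛ.mem_of_consequence [_] (List.forall_mem_singleton.2 (hΛ.dual ψ))
        fun v hv => (List.forall_mem_singleton.1 hv).2
  rw [hdual, Γ.neg_mem_iff hΛ, Γ.box_mem_iff hΛ]
  simp only [not_forall, exists_prop]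
  exact exists_congr fun Δ => and_congr_right fun _ => by rw [Δ.neg_mem_iff hΛ, not_not]

/-- The truth lemma, for the valuation that a substitution induces on the canonical frame. -/
theorem holds_iff_subst_mem (hΛ : IsNormalLogic Λ) (σ : ℕ → MLFormula) (φ : MLFormula)
    (Γ : CanonicalWorld Λ) :
    φ.Holds (canonicalRel Λ) (fun p => {Δ | σ p ∈ Δ.1}) Γ ↔ φ.subst σ ∈ Γ.1 := by
  induction φ generalizing Γ with
  | var p => exact Iff.rfl
  | bot => exact (iff_false_intro (Γ.bot_notMem hΛ)).symm
  | top => exact (iff_true_intro (Γ.mem_of_mem_logic hΛ (hΛ.taut top fun _ => trivial))).symm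
  | neg φ ih => exact (not_congr (ih Γ)).trans (Γ.neg_mem_iff hΛ).symm
  | or φ ψ ih₁ ih₂ => exact (or_congr (ih₁ Γ) (ih₂ Γ)).trans (Γ.or_mem_iff hΛ).symm
  | and φ ψ ih₁ ih₂ => exact (and_congr (ih₁ Γ) (ih₂ Γ)).trans (Γ.and_mem_iff hΛ).symm
  | dia φ ih =>
    exact (exists_congr fun Δ => and_congr_right fun _ => ih Δ).trans (Γ.dia_mem_iff hΛ).symm
  | box φ ih =>
    exact (forall_congr' fun Δ => imp_congr_right fun _ => ih Δ).trans (Γ.box_mem_iff hΛ).symm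

/-! ### The canonical frame as a descriptive frame -/

/-- The topology with the sets `{Γ | ψ ∈ Γ}` as a basis. -/
instance : TopologicalSpace (CanonicalWorld Λ) :=
  TopologicalSpace.generateFrom (Set.range fun ψ => {Γ : CanonicalWorld Λ | ψ ∈ Γ.1})

theorem isTopologicalBasis (hΛ : IsNormalLogic Λ) : TopologicalSpace.IsTopologicalBasis
    (Set.range fun ψ => {Γ : CanonicalWorld Λ | ψ ∈ Γ.1}) where
  exists_subset_inter := by
    rintro _ ⟨φ, rfl⟩ _ ⟨ψ, rfl⟩ Γ hΓ
    exact ⟨_, ⟨φ.and ψ, rfl⟩, (Γ.and_mem_iff hΛ).2 hΓ, fun Δ hΔ => (Δ.and_mem_iff hΛ).1 hΔ⟩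
  sUnion_eq := Set.eq_univ_of_forall fun Γ =>
    ⟨_, ⟨top, rfl⟩, Γ.mem_of_mem_logic hΛ (hΛ.taut top fun _ => trivial)⟩
  eq_generateFrom := rfl

theorem isOpen_setOf_mem (ψ : MLFormula) : IsOpen {Γ : CanonicalWorld Λ | ψ ∈ Γ.1} :=
  TopologicalSpace.isOpen_generateFrom_of_mem ⟨ψ, rfl⟩

theorem isClopen_setOf_mem (hΛ : IsNormalLogic Λ) (ψ : MLFormula) :
    IsClopen {Γ : CanonicalWorld Λ | ψ ∈ Γ.1} := by
  refine ⟨⟨?_⟩, isOpen_setOf_mem ψ⟩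
  convert isOpen_setOf_mem (Λ := Λ) ψ.neg using 1
  ext Γ
  exact (Γ.neg_mem_iff hΛ).symm

/-- An ultrafilter on the worlds converges to the set of the formulae that are contained in almost
all worlds. -/
theorem compactSpace (hΛ : IsNormalLogic Λ) : CompactSpace (CanonicalWorld Λ) := by
  refine ⟨isCompact_iff_ultrafilter_le_nhds.2 fun F _ => ?_⟩
  let Γ : Set MLFormula := {ψ | {Δ : CanonicalWorld Λ | ψ ∈ Δ.1} ∈ F}
  have hcons : LogicConsistent Λ Γ := fun l hl => by
    have hmem : {Δ : CanonicalWorld Λ | ∀ φ ∈ l, φ ∈ Δ.1} ∈ F := by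
      have : {Δ : CanonicalWorld Λ | ∀ φ ∈ l, φ ∈ Δ.1} =
          ⋂ φ ∈ {φ | φ ∈ l}, {Δ : CanonicalWorld Λ | φ ∈ Δ.1} := by
        ext
        simp
      rw [this]
      exact (Filter.biInter_mem (List.finite_toSet l)).2 hl
    obtain ⟨Δ, hΔ⟩ := F.nonempty_of_mem hmem
    exact Δ.2.1 l hΔ
  have hmax : ∀ Δ, LogicConsistent Λ Δ → Γ ⊆ Δ → Δ = Γ := fun Δ hΔ hΓΔ => by
    refine Set.Subset.antisymm (fun ψ hψ => ?_) hΓΔ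
    by_contra hn
    have hneg : ψ.neg ∈ Γ := by
      have h : {Δ : CanonicalWorld Λ | ψ ∈ Δ.1}ᶜ ∈ F := Ultrafilter.compl_mem_iff_notMem.2 hn
      have heq : {Δ : CanonicalWorld Λ | ψ.neg ∈ Δ.1} = {Δ : CanonicalWorld Λ | ψ ∈ Δ.1}ᶜ := by
        ext Δ
        exact Δ.neg_mem_iff hΛ
      rwa [← heq] at h
    obtain ⟨Δ', hΔ'⟩ := exists_canonicalWorld_superset hΔ
    exact (Δ'.neg_mem_iff hΛ).1 (hΔ' (hΓΔ hneg)) (hΔ' hψ)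
  let Γ' : CanonicalWorld Λ := ⟨Γ, hcons, hmax⟩
  refine ⟨Γ', trivial, ?_⟩
  rw [TopologicalSpace.nhds_generateFrom]
  refine le_iInf₂ fun s hs => ?_
  obtain ⟨hΓ, ψ, rfl⟩ := hs
  exact Filter.le_principal_iff.2 hΓ

theorem t1Space (hΛ : IsNormalLogic Λ) : T1Space (CanonicalWorld Λ) := by
  refine ⟨fun Γ => ?_⟩
  have h : ({Γ} : Set (CanonicalWorld Λ)) = ⋂ ψ ∈ Γ.1, {Δ | ψ ∈ Δ.1} := by
    ext Δ
    simp only [Set.mem_singleton_iff, Set.mem_iInter]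
    refine ⟨?_, fun h => Subtype.ext (Γ.2.2 _ Δ.2.1 h)⟩
    rintro rfl
    exact fun _ h => h
  rw [h]
  exact isClosed_biInter fun ψ _ => (isClopen_setOf_mem hΛ ψ).isClosed

theorem isDescriptive (hΛ : IsNormalLogic Λ) : IsDescriptive (canonicalRel Λ) where
  isClosed_rel := by
    have h : {a : CanonicalWorld Λ × CanonicalWorld Λ | canonicalRel Λ a.1 a.2} =
        ⋂ φ : MLFormula, (Prod.fst ⁻¹' {Γ | φ.box ∈ Γ.1}ᶜ) ∪ (Prod.snd ⁻¹' {Δ | φ ∈ Δ.1}) := by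
      ext a
      simp [canonicalRel, imp_iff_not_or]
    rw [h]
    exact isClosed_iInter fun φ =>
      ((isOpen_setOf_mem _).isClosed_compl.preimage continuous_fst).union
        ((isClopen_setOf_mem hΛ φ).isClosed.preimage continuous_snd)
  isOpen_dia O hO := by
    refine isOpen_iff_forall_mem_open.2 ?_
    rintro Γ ⟨Δ, hΔ, hΔO⟩
    obtain ⟨_, ⟨ψ, rfl⟩, hψ, hψO⟩ := (isTopologicalBasis hΛ).exists_subset_of_mem_open hΔO hO
    refine ⟨_, fun Γ' hΓ' => ?_, isOpen_setOf_mem ψ.dia, (Γ.dia_mem_iff hΛ).2 ⟨Δ, hΔ, hψ⟩⟩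
    obtain ⟨Δ', hΔ', hψ'⟩ := (Γ'.dia_mem_iff hΛ).1 hΓ'
    exact ⟨Δ', hΔ', hψO hψ'⟩
  isTopologicalBasis := by
    refine (isTopologicalBasis hΛ).of_isOpen_of_subset (fun U hU => hU.isOpen) ?_
    rintro _ ⟨ψ, rfl⟩
    exact isClopen_setOf_mem hΛ ψ

theorem exists_eq_setOf_mem (hΛ : IsNormalLogic Λ) {U : Set (CanonicalWorld Λ)}
    (hU : IsClopen U) : ∃ ψ, U = {Γ | ψ ∈ Γ.1} := by
  have := compactSpace hΛ
  obtain ⟨s, hs, hUs⟩ := eq_finite_iUnion_of_isTopologicalBasis_of_isCompact_open _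
    (isTopologicalBasis hΛ) U hU.isClosed.isCompact hU.isOpen
  clear hU
  induction s, hs using Set.Finite.induction_on generalizing U with
  | empty =>
    refine ⟨bot, hUs.trans ?_⟩
    ext Γ
    simpa using Γ.bot_notMem hΛ
  | @insert φ _ _ _ ih =>
    obtain ⟨ψ, hψ⟩ := ih rfl
    refine ⟨φ.or ψ, ?_⟩
    rw [hUs, Set.biUnion_insert, hψ]
    ext Γ
    exact (Γ.or_mem_iff hΛ).symm

end CanonicalWorld

end Consistency

/-! ### Canonicity -/

/-- A refutation on the canonical frame could be taken under a clopen valuation, hence under one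
that is induced by a substitution; then a substitution instance of `φ` would be missing from a
world, although it belongs to the logic. -/
theorem IsMonadicInductive.isCanonical {φ : MLFormula} (hφ : IsMonadicInductive φ) :
    φ.IsCanonical := by
  intro Λ hΛ hmem Γ V
  have := CanonicalWorld.compactSpace hΛ
  have := CanonicalWorld.t1Space hΛ
  by_contra hΓ
  obtain ⟨U, hU, hUΓ⟩ := hφ.exists_clopen_valuation (CanonicalWorld.isDescriptive hΛ) hΓ
  choose σ hσ using fun p => CanonicalWorld.exists_eq_setOf_mem hΛ (hU p)
  obtain rfl : U = _ := funext hσ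
  exact hUΓ ((Γ.holds_iff_subst_mem hΛ σ φ).2 (Γ.mem_of_mem_logic hΛ (hΛ.subst φ σ hmem)))

theorem mainTheorem4 (φ : MLFormula) (hφ : IsMonadicInductive φ) :
    MLFormula.LocallyFirstOrderDefinable.{u} φ ∧ φ.IsCanonical :=
  ⟨hφ.locallyFirstOrderDefinable, hφ.isCanonical⟩
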